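/- **Setting.** Let $N_A > N_E \ge N_B \ge 1$ be integers, let $\varepsilon\in(0,1)$, $P_v>0$, let $M$ be a perfect square and $B\ge 1$. In the channel uses $i=1,\dots,B$, let $H_i\in\mathbb C^{N_B\times N_A}$ be arbitrary fixed matrices with singular value decompositions $H_i=U_i\Lambda_iV_i^H$, and write $V_i=[V_{1,i},Z_i]$, where $V_{1,i}$ consists of the first $N_B$ columns. Let $G_i\in\mathbb C^{N_E\times N_A}$ be independent random matrices with i.i.d. $\mathcal N_{\mathbb C}(0,1)$ entries, let $u_i$ be independent and uniform on $\tilde{\mathcal Q}^{N_B}$, where $\tilde{\mathcal Q}=\{a+b\sqrt{-1}: a,b\in\{0,1,\dots,\sqrt M-1\}\}$, and let $v_i\in\mathbb C^{N_A-N_B}$ be independent random vectors with arbitrary laws on the ball $\|v\|^2\le P_v$; the families $(G_i)$, $(u_i)$, $(v_i)$ are mutually independent. The eavesdropper receives $y_i=G_iV_{1,i}u_i+G_iZ_iv_i$. Put $R_{\max,i}=\max_{\|v\|^2\le P_v}\|G_iZ_iv\|$, $\Lambda_{F,i}=\{G_iV_{1,i}u: u\in\tilde{\mathcal Q}^{N_B}\}$,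 and let $L_i$ be the number of points of $\Lambda_{F,i}$ in the closed ball with centre $y_i$ and radius $R_{\max,i}$. For an integer $d\ge2$ let $$P_{F,\mathrm{out}}(d,B)=\Pr\{L_1<d,\dots,L_B<d\},$$ $$\kappa(d)=\frac{d^{1/(2N_E)}}{\sqrt\pi},\qquad \Phi=\Big[\frac{(N_E-N_B)!}{N_E!}\Big]^{1/(2N_B)},\qquad N_{\min}=\min\{N_E-N_B+1,\;N_B\}.$$ The eavesdropper's equivocation about the message is $\sum_{i=1}^B H_i^{\rm post}$, where $H_i^{\rm post}$ is the entropy of the uniform law on $\tilde{\mathcal Q}^{N_B}$ conditioned on the set of those $u'$ for which $G_iV_{1,i}u'$ lies in that ball; secrecy is ideal if the equivocation is nonzero. **Theorem 3.** For all $N_A>N_E\ge N_B\ge1$ and $d\ge2$ there is a constant $C>0$, depending only on $N_A,N_B,N_E,d$, such that for every $\varepsilon\in(0,1)$, if $$P_v=\varepsilon^{-2/N_{\min}}\,\kappa(d)^2/\Phi^{2N_B/N_E}\qquad\text{and}\qquad M\ge\varepsilon^{-3-2/N_{\min}}\,\kappa(d)^2,$$ then for every $B\ge1$, all $H_1,\dots,H_B$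 and all admissible laws of the $v_i$, $$P_{F,\mathrm{out}}(d,B)<(C\varepsilon)^B,$$ which is $O(\varepsilon^B)$ for fixed $B$. Consequently ideal secrecy is achieved with probability greater than $1-(C\varepsilon)^B$. -/

import Mathlib

open MeasureTheory ProbabilityTheory
open scoped NNReal Matrix Nat

namespace USK

noncomputable section

/-- The circularly symmetric complex Gaussian law `𝒩_ℂ(0, s)`: independent real and imaginary
parts, each real Gaussian with mean `0` and variance `s / 2`. -/
def complexGaussian (s : ℝ≥0) : Measure ℂ :=
  ((gaussianReal 0 (s / 2)).prod (gaussianReal 0 (s / 2))).map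
    (fun p : ℝ × ℝ => (p.1 : ℂ) + (p.2 : ℂ) * Complex.I)

/-- The Euclidean length of a complex vector. -/
def len {n : ℕ} (x : Fin n → ℂ) : ℝ := ‖(WithLp.toLp 2 x : EuclideanSpace ℂ (Fin n))‖

/-- `H = U Λ Vᴴ` is a singular value decomposition: `U`, `V` are unitary and `Λ` is the rectangular
diagonal matrix with the nonnegative diagonal entries `σ`. -/
structure IsSVD {m n : ℕ} (H : Matrix (Fin m) (Fin n) ℂ) (U : Matrix (Fin m) (Fin m) ℂ)
    (σ : Fin m → ℝ) (V : Matrix (Fin n) (Fin n) ℂ) : Prop where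
  unitary_left : U ∈ Matrix.unitaryGroup (Fin m) ℂ
  unitary_right : V ∈ Matrix.unitaryGroup (Fin n) ℂ
  nonneg : ∀ i, 0 ≤ σ i
  eq_mul : H = U * (Matrix.of fun (i : Fin m) (j : Fin n) =>
    if (i : ℕ) = (j : ℕ) then (σ i : ℂ) else 0) * Vᴴ

/-- `V₁`: the first `NB` columns of the matrix `V` of right-singular vectors. -/
def leftBlock {NA NB : ℕ} (h : NB ≤ NA) (V : Matrix (Fin NA) (Fin NA) ℂ) :
    Matrix (Fin NA) (Fin NB) ℂ :=
  V.submatrix id (Fin.castLE h)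

/-- `Z`: the remaining `NA - NB` columns of `V`. -/
def rightBlock {NA NB : ℕ} (h : NB ≤ NA) (V : Matrix (Fin NA) (Fin NA) ℂ) :
    Matrix (Fin NA) (Fin (NA - NB)) ℂ :=
  V.submatrix id (fun j : Fin (NA - NB) => (⟨NB + j, by omega⟩ : Fin NA))

/-- The `M`-QAM constellation with real and imaginary parts in `{0, 1, …, √M - 1}`
(used for perfect squares `M`). -/
def qam (M : ℕ) : Set ℂ :=
  {z | ∃ a b : ℕ, a < Nat.sqrt M ∧ b < Nat.sqrt M ∧ z = (a : ℂ) + (b : ℂ) * Complex.I}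

/-- The vectors of length `n` with entries in the `M`-QAM constellation. -/
def qamVec (M n : ℕ) : Set (Fin n → ℂ) := {x | ∀ k, x k ∈ qam M}

/-- The ball `{v : ‖v‖² ≤ Pv}` of admissible artificial-noise keys. -/
def keySet (n : ℕ) (Pv : ℝ) : Set (Fin n → ℂ) := {v | len v ^ 2 ≤ Pv}

/-- `R_max = max {‖W v‖ : ‖v‖² ≤ Pv}`, where `W` stands for `G Z`. -/
def Rmax {m n : ℕ} (W : Matrix (Fin m) (Fin n) ℂ) (Pv : ℝ) : ℝ :=
  sSup ((fun v => len (W *ᵥ v)) '' keySet n Pv)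

/-- The finite lattice constellation `Λ_F = {A u : u ∈ qamVec M n}`, where `A` stands for `G V₁`. -/
def finiteLattice {m n : ℕ} (A : Matrix (Fin m) (Fin n) ℂ) (M : ℕ) : Set (Fin m → ℂ) :=
  (fun x => A *ᵥ x) '' qamVec M n

/-- The closed Euclidean ball with centre `y` and radius `R`. -/
def ball {m : ℕ} (y : Fin m → ℂ) (R : ℝ) : Set (Fin m → ℂ) := {p | len (p - y) ≤ R}

/-- The Shannon entropy (natural logarithm) of a discrete law. -/
def entropy {α : Type*} [MeasurableSpace α] (p : Measure α) : ℝ :=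
  ∑' x, Real.negMulLog (p.real {x})

/-- `B` uses of the artificial-noise channel with `M`-QAM inputs and peak noise power `Pv`, on a
probability space `(Ω, μ)`. Bob's channels `H i` are arbitrary fixed matrices; Eve's channels `G i`
are random. -/
structure Scheme (NA NB NE M : ℕ) (Pv : ℝ) (B : ℕ) {Ω : Type*} [MeasurableSpace Ω]
    (μ : Measure Ω) where
  /-- Bob's channel matrices, with their singular value decompositions. -/
  H : Fin B → Matrix (Fin NB) (Fin NA) ℂ
  U : Fin B → Matrix (Fin NB) (Fin NB) ℂ
  σ : Fin B → Fin NB → ℝ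
  V : Fin B → Matrix (Fin NA) (Fin NA) ℂ
  svd : ∀ i, IsSVD (H i) (U i) (σ i) (V i)
  /-- Eve's channel matrices, the transmitted vectors, and the artificial-noise keys. -/
  G : Fin B → Ω → Matrix (Fin NE) (Fin NA) ℂ
  u : Fin B → Ω → Fin NB → ℂ
  v : Fin B → Ω → Fin (NA - NB) → ℂ
  measurable_G : ∀ i j k, Measurable fun ω => G i ω j k
  measurable_u : ∀ i, Measurable (u i)
  measurable_v : ∀ i, Measurable (v i)
  /-- All entries of all the `G i` are i.i.d. `𝒩_ℂ(0, 1)`. -/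
  law_G : ∀ i j k, HasLaw (fun ω => G i ω j k) (complexGaussian 1) μ
  indep_G : iIndepFun (fun (p : Fin B × Fin NE × Fin NA) ω => G p.1 ω p.2.1 p.2.2) μ
  /-- The `u i` are independent and uniform on the constellation. -/
  law_u : ∀ i, HasLaw (u i) (uniformOn (qamVec M NB)) μ
  indep_u : iIndepFun u μ
  /-- The keys `v i` are independent, with arbitrary laws on the ball of admissible keys. -/
  mem_v : ∀ i, ∀ᵐ ω ∂μ, v i ω ∈ keySet (NA - NB) Pv
  indep_v : iIndepFun v μ
  /-- The channels, the transmitted vectors and the keys are mutually independent. -/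
  indep_u_v : IndepFun (fun ω i => u i ω) (fun ω i => v i ω) μ
  indep_G_uv : IndepFun (fun ω (p : Fin B × Fin NE × Fin NA) => G p.1 ω p.2.1 p.2.2)
    (fun ω => ((fun i => u i ω), (fun i => v i ω))) μ

namespace Scheme

variable {NA NB NE M : ℕ} {Pv : ℝ} {B : ℕ} {Ω : Type*} [MeasurableSpace Ω] {μ : Measure Ω}

/-- `G V₁` in the `i`-th channel use. -/
def GV (S : Scheme NA NB NE M Pv B μ) (h : NB ≤ NA) (i : Fin B) (ω : Ω) :
    Matrix (Fin NE) (Fin NB) ℂ := S.G i ω * leftBlock h (S.V i)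

/-- `G Z` in the `i`-th channel use. -/
def GZ (S : Scheme NA NB NE M Pv B μ) (h : NB ≤ NA) (i : Fin B) (ω : Ω) :
    Matrix (Fin NE) (Fin (NA - NB)) ℂ := S.G i ω * rightBlock h (S.V i)

/-- The (noiseless) signal `y = G V₁ u + G Z v` received by Eve in the `i`-th channel use. -/
def y (S : Scheme NA NB NE M Pv B μ) (h : NB ≤ NA) (i : Fin B) (ω : Ω) : Fin NE → ℂ :=
  S.GV h i ω *ᵥ S.u i ω + S.GZ h i ω *ᵥ S.v i ω

/-- The ball with centre `y` and radius `R_max` in the `i`-th channel use. -/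
def sphere (S : Scheme NA NB NE M Pv B μ) (h : NB ≤ NA) (i : Fin B) (ω : Ω) : Set (Fin NE → ℂ) :=
  ball (S.y h i ω) (Rmax (S.GZ h i ω) Pv)

/-- The number `L i` of points of the finite lattice constellation in that ball. -/
def L (S : Scheme NA NB NE M Pv B μ) (h : NB ≤ NA) (i : Fin B) (ω : Ω) : ℕ :=
  (S.sphere h i ω ∩ finiteLattice (S.GV h i ω) M).ncard

/-- The secrecy outage probability `Pr {L 1 < d, …, L B < d}`. -/
def outageProb (S : Scheme NA NB NE M Pv B μ) (h : NB ≤ NA) (d : ℕ) : ℝ :=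
  μ.real {ω | ∀ i, S.L h i ω < d}

/-- The vectors that are compatible with what Eve knows in the `i`-th channel use. -/
def candidates (S : Scheme NA NB NE M Pv B μ) (h : NB ≤ NA) (i : Fin B) (ω : Ω) :
    Set (Fin NB → ℂ) :=
  {x | S.GV h i ω *ᵥ x ∈ S.sphere h i ω ∩ finiteLattice (S.GV h i ω) M}

/-- Eve's posterior law of the transmitted vector: she does not know the law of the key, so it is
the uniform prior conditioned on the set of candidates. -/
def posterior (S : Scheme NA NB NE M Pv B μ) (h : NB ≤ NA) (i : Fin B) (ω : Ω) :
    Measure (Fin NB → ℂ) :=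
  cond (uniformOn (qamVec M NB)) (S.candidates h i ω)

/-- Eve's equivocation about the message sent in the `B` channel uses. -/
def equivocation (S : Scheme NA NB NE M Pv B μ) (h : NB ≤ NA) (ω : Ω) : ℝ :=
  ∑ i, entropy (S.posterior h i ω)

/-- The probability of ideal secrecy, that is, of a nonzero equivocation. -/
def idealSecrecyProb (S : Scheme NA NB NE M Pv B μ) (h : NB ≤ NA) : ℝ :=
  μ.real {ω | S.equivocation h ω ≠ 0}

end Scheme

/-- `κ(d) = d^{1/(2 NE)} / √π`. -/
def kappa (NE d : ℕ) : ℝ := (d : ℝ) ^ (1 / (2 * (NE : ℝ))) / √Real.pi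

/-- `Φ = ((NE - NB)! / NE!)^{1/(2 NB)}`. -/
def Phi (NB NE : ℕ) : ℝ := (((NE - NB)! : ℝ) / (NE ! : ℝ)) ^ (1 / (2 * (NB : ℝ)))

/-- `N_min = min {NE - NB + 1, NB}`. -/
def Nmin (NB NE : ℕ) : ℕ := min (NE - NB + 1) NB

end

end USK

open scoped ENNReal

instance isProbabilityMeasure_complexGaussian (s : ℝ≥0) :
    IsProbabilityMeasure (USK.complexGaussian s) := by
  unfold USK.complexGaussian
  exact Measure.isProbabilityMeasure_map (by fun_prop)

lemma charFun_complexGaussian_one (t : ℂ) :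
    charFun (USK.complexGaussian 1) t = Complex.exp (-((‖t‖ ^ 2 / 4 : ℝ) : ℂ)) := by
  have h : charFun (USK.complexGaussian 1) t
      = charFun (gaussianReal 0 (1 / 2)) t.re * charFun (gaussianReal 0 (1 / 2)) t.im := by
    rw [charFun_apply, USK.complexGaussian, integral_map (by fun_prop) (by fun_prop),
      charFun_apply, charFun_apply, ← integral_prod_mul]
    congr 1 with p
    rw [← Complex.exp_add]
    congr 1
    simp [Complex.inner]
    ring
  rw [h, charFun_gaussianReal, charFun_gaussianReal, ← Complex.exp_add, Complex.sq_norm,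
    Complex.normSq_apply]
  congr 1
  push_cast
  ring

/-- The standard complex Gaussian law on `ι → ℂ`. -/
noncomputable def stdComplexGaussian (ι : Type*) [Fintype ι] : Measure (ι → ℂ) :=
  Measure.pi fun _ => USK.complexGaussian 1

instance isProbabilityMeasure_stdComplexGaussian (ι : Type*) [Fintype ι] :
    IsProbabilityMeasure (stdComplexGaussian ι) := by
  unfold stdComplexGaussian; infer_instance

lemma measurable_vecMul {ι κ : Type*} [Fintype ι] (Q : Matrix ι κ ℂ) :
    Measurable fun x : ι → ℂ => x ᵥ* Q := by
  refine measurable_pi_lambda _ fun j => ?_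
  simp only [Matrix.vecMul, dotProduct]
  fun_prop

/-- A standard complex Gaussian row vector times a matrix with orthonormal columns is standard
complex Gaussian. -/
lemma stdComplexGaussian_map_vecMul {ι κ : Type*} [Fintype ι] [Fintype κ] [DecidableEq κ]
    (Q : Matrix ι κ ℂ) (hQ : Qᴴ * Q = 1) :
    (stdComplexGaussian ι).map (fun x => x ᵥ* Q) = stdComplexGaussian κ := by
  have : IsProbabilityMeasure ((stdComplexGaussian ι).map (fun x => x ᵥ* Q)) :=
    Measure.isProbabilityMeasure_map (measurable_vecMul Q).aemeasurable
  refine charFun_eq_pi_iff.1 fun t => ?_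
  have hin : ∀ x : ι → ℂ, inner ℝ (WithLp.toLp 2 (x ᵥ* Q) : EuclideanSpace ℂ κ) t
      = inner ℝ (WithLp.toLp 2 x : EuclideanSpace ℂ ι)
        (WithLp.toLp 2 (star (Q *ᵥ star (t : κ → ℂ)))) := by
    intro x
    have h1 : ∀ z w : ℂ, inner ℝ z w = (z * star w).re := by
      intro z w; rw [Complex.inner]; simp; ring
    simp only [PiLp.inner_apply, h1, Pi.star_apply, star_star, ← Complex.re_sum]
    congr 1
    have := Matrix.dotProduct_mulVec x Q (star (t : κ → ℂ))
    simpa [dotProduct] using this.symm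
  have hn : ∑ i, ‖(Q *ᵥ star (t : κ → ℂ)) i‖ ^ 2 = ∑ j, ‖t j‖ ^ 2 := by
    have h2 : star (Q *ᵥ star (t : κ → ℂ)) ⬝ᵥ (Q *ᵥ star (t : κ → ℂ))
        = (t : κ → ℂ) ⬝ᵥ star (t : κ → ℂ) := by
      rw [Matrix.star_mulVec, Matrix.dotProduct_mulVec, Matrix.vecMul_vecMul, hQ, Matrix.vecMul_one,
        star_star]
    have h3 := congrArg Complex.re h2
    simp only [dotProduct, Complex.re_sum, Pi.star_apply] at h3
    refine Eq.trans ?_ (h3.trans ?_)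
    · refine Finset.sum_congr rfl fun i _ => ?_
      rw [Complex.sq_norm, Complex.normSq_apply]; simp
    · refine Finset.sum_congr rfl fun i _ => ?_
      rw [Complex.sq_norm, Complex.normSq_apply]; simp
  have h4 : charFun (((stdComplexGaussian ι).map (fun x => x ᵥ* Q)).map (WithLp.toLp 2)) t
      = charFun ((stdComplexGaussian ι).map (WithLp.toLp 2))
        (WithLp.toLp 2 (star (Q *ᵥ star (t : κ → ℂ))) : EuclideanSpace ℂ ι) := by
    rw [charFun_apply, charFun_apply, Measure.map_map (by fun_prop) (measurable_vecMul Q),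
      integral_map ((WithLp.measurable_toLp 2 _).comp (measurable_vecMul Q)).aemeasurable
        (by fun_prop),
      integral_map (by fun_prop) (by fun_prop)]
    simp only [Function.comp_apply, hin]
  rw [h4, stdComplexGaussian, charFun_pi]
  simp only [charFun_complexGaussian_one, Pi.star_apply, norm_star]
  rw [← Complex.exp_sum, ← Complex.exp_sum]
  congr 1
  rw [Finset.sum_neg_distrib, Finset.sum_neg_distrib, ← Complex.ofReal_sum, ← Complex.ofReal_sum,
    ← Finset.sum_div, ← Finset.sum_div, hn]

lemma stdComplexGaussian_map_curry (ι κ : Type*) [Fintype ι] [Fintype κ] :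
    (stdComplexGaussian (ι × κ)).map (fun x i j => x (i, j))
      = Measure.pi fun _ : ι => stdComplexGaussian κ := by
  have := Measure.infinitePi_map_curry (X := ℂ) (fun (_ : ι) (_ : κ) => USK.complexGaussian 1)
  simp only [Measure.infinitePi_eq_pi] at this
  exact this

lemma stdComplexGaussian_map_precomp {ι κ : Type*} [Fintype ι] [Fintype κ] {f : κ → ι}
    (hf : f.Injective) :
    (stdComplexGaussian ι).map (fun x i => x (f i)) = stdComplexGaussian κ := by
  have := Measure.map_infinitePi_infinitePi_of_inj (P := fun _ : ι => USK.complexGaussian 1) hf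
  simp only [Measure.infinitePi_eq_pi] at this
  exact this

/-- The columns of a standard Gaussian matrix are independent standard Gaussian vectors. -/
lemma pi_stdComplexGaussian_map_swap (ι κ : Type*) [Fintype ι] [Fintype κ] :
    (Measure.pi fun _ : ι => stdComplexGaussian κ).map (fun x j i => x i j)
      = Measure.pi fun _ : κ => stdComplexGaussian ι := by
  rw [← stdComplexGaussian_map_curry, ← stdComplexGaussian_map_curry,
    ← stdComplexGaussian_map_precomp (f := (Prod.swap : κ × ι → ι × κ)) Prod.swap_injective,
    Measure.map_map (by fun_prop) (by fun_prop), Measure.map_map (by fun_prop) (by fun_prop)]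
  rfl

lemma lintegral_pi_prod {ι : Type*} [Fintype ι] {X : ι → Type*} [∀ i, MeasurableSpace (X i)]
    (μ : ∀ i, Measure (X i)) [∀ i, IsProbabilityMeasure (μ i)] {f : ∀ i, X i → ℝ≥0∞}
    (hf : ∀ i, Measurable (f i)) :
    ∫⁻ x, ∏ i, f i (x i) ∂(Measure.pi μ) = ∏ i, ∫⁻ x, f i x ∂(μ i) := by
  have h := lintegral_prod_eq_prod_lintegral_of_indepFun Finset.univ
    (fun i (x : ∀ i, X i) => f i (x i)) (iIndepFun_pi (μ := μ) fun i => (hf i).aemeasurable)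
    (fun i => (hf i).comp (measurable_pi_apply i))
  rw [h]
  refine Finset.prod_congr rfl fun i _ => ?_
  exact (measurePreserving_eval μ i).lintegral_comp (hf i)

lemma lintegral_inv_gaussianReal_lt_top :
    ∫⁻ x, ‖x‖ₑ ^ (-(3 / 4) : ℝ) ∂(gaussianReal 0 (1 / 2)) < ∞ := by
  have hint : Integrable (fun x : ℝ => |x| ^ (-(3 / 4) : ℝ) * Real.exp (-|x| ^ (2 : ℝ))) := by
    by_contra h
    have h1 := integral_undef h
    rw [integral_comp_abs (f := fun x => x ^ (-(3 / 4) : ℝ) * Real.exp (-x ^ (2 : ℝ))),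
      integral_rpow_mul_exp_neg_rpow (by norm_num) (by norm_num)] at h1
    have := Real.Gamma_pos_of_pos (s := (-(3 / 4) + 1) / 2) (by norm_num)
    linarith
  rw [gaussianReal_of_var_ne_zero _ (by norm_num),
    lintegral_withDensity_eq_lintegral_mul _ (measurable_gaussianPDF _ _) (by fun_prop)]
  refine lt_of_le_of_lt ?_ hint.2
  refine lintegral_mono_ae ?_
  have hne : ∀ᵐ x : ℝ, x ≠ 0 := by rw [ae_iff]; simp
  filter_upwards [hne] with x hx
  have hx' : 0 < |x| := abs_pos.2 hx
  rw [Pi.mul_apply, Real.enorm_eq_ofReal_abs, ENNReal.ofReal_rpow_of_pos hx', gaussianPDF,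
    ← ENNReal.ofReal_mul (gaussianPDFReal_nonneg _ _ _),
    Real.enorm_eq_ofReal (by positivity), mul_comm]
  refine ENNReal.ofReal_le_ofReal (mul_le_mul_of_nonneg_left ?_ (by positivity))
  have h1 : (√(2 * Real.pi * ((1 / 2 : ℝ≥0) : ℝ)))⁻¹ ≤ 1 := by
    refine inv_le_one_of_one_le₀ (Real.one_le_sqrt.2 ?_)
    push_cast
    linarith [Real.pi_gt_three]
  have h2 : (-(x - 0) ^ 2 / (2 * ((1 / 2 : ℝ≥0) : ℝ))) = -|x| ^ (2 : ℝ) := by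
    rw [Real.rpow_two, sq_abs]; push_cast; ring
  rw [gaussianPDFReal, h2]
  exact mul_le_of_le_one_left (Real.exp_pos _).le h1

lemma lintegral_enorm_pow_complexGaussian_lt_top (p : ℝ≥0) (hp : 0 < p) :
    ∫⁻ z, ‖z‖ₑ ^ (p : ℝ) ∂(USK.complexGaussian 1) < ∞ := by
  have h : MemLp (fun z : ℂ => z) p (USK.complexGaussian 1) := by
    unfold USK.complexGaussian
    rw [memLp_map_measure_iff (by fun_prop) (by fun_prop)]
    have h0 := memLp_id_gaussianReal (μ := 0) (v := 1 / 2) p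
    have h1 : MemLp (fun q : ℝ × ℝ => (q.1 : ℂ)) p
        ((gaussianReal 0 (1 / 2)).prod (gaussianReal 0 (1 / 2))) :=
      (h0.comp_measurePreserving measurePreserving_fst).ofReal
    have h2 : MemLp (fun q : ℝ × ℝ => (q.2 : ℂ)) p
        ((gaussianReal 0 (1 / 2)).prod (gaussianReal 0 (1 / 2))) :=
      (h0.comp_measurePreserving measurePreserving_snd).ofReal
    exact h1.add (h2.mul_const _)
  have := lintegral_rpow_enorm_lt_top_of_eLpNorm_lt_top (p := p) (by simpa using hp.ne') (by simp)
    h.2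
  simpa using this

lemma lintegral_enorm_inv_complexGaussian_lt_top :
    ∫⁻ z, ‖z‖ₑ ^ (-(3 / 2) : ℝ) ∂(USK.complexGaussian 1) < ∞ := by
  unfold USK.complexGaussian
  rw [lintegral_map (by fun_prop) (by fun_prop)]
  calc _ ≤ ∫⁻ p : ℝ × ℝ, ‖p.1‖ₑ ^ (-(3 / 4) : ℝ) * ‖p.2‖ₑ ^ (-(3 / 4) : ℝ)
        ∂((gaussianReal 0 (1 / 2)).prod (gaussianReal 0 (1 / 2))) := by
        refine lintegral_mono fun p => ?_
        have hle : ∀ x : ℝ, ‖x‖ ≤ ‖(p.1 : ℂ) + p.2 * Complex.I‖ →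
            ‖(p.1 : ℂ) + p.2 * Complex.I‖ₑ ^ (-(3 / 4) : ℝ) ≤ ‖x‖ₑ ^ (-(3 / 4) : ℝ) := by
          intro x hx
          rw [ENNReal.rpow_neg, ENNReal.rpow_neg, ENNReal.inv_le_inv]
          exact ENNReal.rpow_le_rpow (enorm_le_iff_norm_le.2 hx) (by norm_num)
        rw [show (-(3 / 2) : ℝ) = -(3 / 4) * 2 by norm_num, ENNReal.rpow_mul, ENNReal.rpow_two, sq]
        refine mul_le_mul' (hle _ ?_) (hle _ ?_)
        · simpa using Complex.abs_re_le_norm ((p.1 : ℂ) + p.2 * Complex.I)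
        · simpa using Complex.abs_im_le_norm ((p.1 : ℂ) + p.2 * Complex.I)
    _ = (∫⁻ x, ‖x‖ₑ ^ (-(3 / 4) : ℝ) ∂(gaussianReal 0 (1 / 2)))
        * ∫⁻ x, ‖x‖ₑ ^ (-(3 / 4) : ℝ) ∂(gaussianReal 0 (1 / 2)) := by
        exact lintegral_prod_mul (f := fun x : ℝ => ‖x‖ₑ ^ (-(3 / 4) : ℝ))
          (g := fun x : ℝ => ‖x‖ₑ ^ (-(3 / 4) : ℝ)) (by fun_prop) (by fun_prop)
    _ < ∞ := ENNReal.mul_lt_top lintegral_inv_gaussianReal_lt_top lintegral_inv_gaussianReal_lt_top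

/-- The constant in the small-ball estimate for the projection of a Gaussian vector. -/
noncomputable def smallBallConst (ι : Type*) [Fintype ι] : ℝ≥0∞ :=
  1 + ∫⁻ a, ‖(WithLp.toLp 2 a : EuclideanSpace ℂ ι)‖ₑ ^ (6 : ℝ) ∂(stdComplexGaussian ι)
    + ∫⁻ z, ‖z‖ₑ ^ (-(3 / 2) : ℝ) ∂(USK.complexGaussian 1)

lemma memLp_toLp_stdComplexGaussian (ι : Type*) [Fintype ι] :
    MemLp (fun a : ι → ℂ => (WithLp.toLp 2 a : EuclideanSpace ℂ ι)) 6 (stdComplexGaussian ι) := by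
  have hz : MemLp (fun z : ℂ => z) 6 (USK.complexGaussian 1) := by
    refine ⟨by fun_prop, ?_⟩
    rw [eLpNorm_lt_top_iff_lintegral_rpow_enorm_lt_top (by norm_num) (by norm_num)]
    have := lintegral_enorm_pow_complexGaussian_lt_top 6 (by norm_num)
    simpa using this
  have hs : MemLp (fun a : ι → ℂ => ∑ k, ‖a k‖) 6 (stdComplexGaussian ι) := by
    refine memLp_finsetSum _ fun k _ => ?_
    exact (hz.comp_measurePreserving (measurePreserving_eval _ k)).norm
  refine hs.mono (by fun_prop) (ae_of_all _ fun a => ?_)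
  have h0 : 0 ≤ ∑ k, ‖a k‖ := Finset.sum_nonneg fun k _ => norm_nonneg _
  rw [Real.norm_of_nonneg h0, EuclideanSpace.norm_eq]
  refine Real.sqrt_le_iff.2 ⟨h0, ?_⟩
  exact Finset.sum_sq_le_sq_sum_of_nonneg fun k _ => norm_nonneg _

lemma smallBallConst_lt_top (ι : Type*) [Fintype ι] : smallBallConst ι < ∞ := by
  refine ENNReal.add_lt_top.2 ⟨ENNReal.add_lt_top.2 ⟨ENNReal.one_lt_top, ?_⟩,
    lintegral_enorm_inv_complexGaussian_lt_top⟩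
  have := (memLp_toLp_stdComplexGaussian ι).2
  rw [eLpNorm_lt_top_iff_lintegral_rpow_enorm_lt_top (by norm_num) (by norm_num)] at this
  simpa using this

lemma one_le_of_le_mul_sq {s h A : ℝ} (hh : 0 ≤ h) (hA : 0 ≤ A) (hs : 0 < s) (hle : h ≤ s * A ^ 2) :
    (1 : ℝ≥0∞) ≤ ENNReal.ofReal s *
      (ENNReal.ofReal A ^ (6 : ℝ) + ENNReal.ofReal h ^ (-(3 / 2) : ℝ)) := by
  rcases hh.eq_or_lt with rfl | hh
  · rw [ENNReal.ofReal_zero, ENNReal.zero_rpow_of_neg (by norm_num), add_top,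
      ENNReal.mul_top (by simpa using hs)]
    exact le_top
  · rw [ENNReal.ofReal_rpow_of_nonneg hA (by norm_num), ENNReal.ofReal_rpow_of_pos hh,
      ← ENNReal.ofReal_add (by positivity) (by positivity), ← ENNReal.ofReal_mul hs.le,
      ENNReal.one_le_ofReal]
    obtain ⟨r, hr⟩ : ∃ r, r = h ^ (-(1 / 2) : ℝ) := ⟨_, rfl⟩
    have hr0 : 0 < r := hr ▸ Real.rpow_pos_of_pos hh _
    have hr2 : r ^ 2 * h = 1 := by
      rw [hr, ← Real.rpow_natCast, ← Real.rpow_mul hh.le, ← Real.rpow_add_one hh.ne']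
      norm_num
    have hr3 : h ^ (-(3 / 2) : ℝ) = r ^ 3 := by
      rw [hr, ← Real.rpow_natCast, ← Real.rpow_mul hh.le]
      norm_num
    have hA6 : A ^ (6 : ℝ) = (A ^ 2) ^ 3 := by
      rw [← pow_mul]; exact_mod_cast Real.rpow_natCast A 6
    rw [hA6, hr3]
    have h1 : 1 ≤ s * (A ^ 2 * r ^ 2) := by nlinarith [sq_nonneg r]
    have h2 : A ^ 2 * r ^ 2 ≤ (A ^ 2) ^ 3 + r ^ 3 := by
      obtain ⟨x, hx⟩ : ∃ x, x = A ^ 2 := ⟨_, rfl⟩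
      have hx0 : 0 ≤ x := hx ▸ sq_nonneg A
      rw [← hx]
      rcases le_total x r with h | h
      · nlinarith [mul_le_mul_of_nonneg_right h (sq_nonneg r), pow_nonneg hx0 3]
      · nlinarith [mul_le_mul_of_nonneg_left (pow_le_pow_left₀ hr0.le h 2) hx0, pow_pos hr0 3]
    exact h1.trans (mul_le_mul_of_nonneg_left h2 hs.le)

lemma stdComplexGaussian_map_inner {ι : Type*} [Fintype ι] (n : EuclideanSpace ℂ ι)
    (hn : ‖n‖ = 1) :
    (stdComplexGaussian ι).map (fun a => inner ℂ n (WithLp.toLp 2 a)) = USK.complexGaussian 1 := by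
  have h := stdComplexGaussian_map_vecMul (Matrix.of fun k (_ : Unit) => star (n k)) (by
    ext i j
    have h1 : inner ℂ n n = (1 : ℂ) := by rw [inner_self_eq_norm_sq_to_K, hn]; simp
    rw [EuclideanSpace.inner_eq_star_dotProduct, dotProduct_comm] at h1
    simpa [Matrix.mul_apply, dotProduct, mul_comm] using h1)
  have h2 := congrArg (Measure.map (fun x : Unit → ℂ => x ())) h
  rw [Measure.map_map (by fun_prop) (measurable_vecMul _),
    show (stdComplexGaussian Unit).map (fun x : Unit → ℂ => x ()) = USK.complexGaussian 1 from
      (measurePreserving_eval (fun _ : Unit => USK.complexGaussian 1) ()).map_eq] at h2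
  rw [← h2]
  congr 1

/-- The projection of a Gaussian vector on a fixed direction is rarely small against the squared
length of the vector. -/
lemma stdComplexGaussian_inner_le {ι : Type*} [Fintype ι] (n : EuclideanSpace ℂ ι)
    {τ : ℝ} (hτ : 0 < τ) :
    stdComplexGaussian ι {a | ‖inner ℂ n (WithLp.toLp 2 a)‖
        ≤ τ * ‖(WithLp.toLp 2 a : EuclideanSpace ℂ ι)‖ ^ 2}
      ≤ (ENNReal.ofReal τ * smallBallConst ι) * ‖n‖ₑ⁻¹ := by
  rcases eq_or_ne n 0 with rfl | hn
  · rw [enorm_zero, ENNReal.inv_zero, ENNReal.mul_top]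
    · exact le_top
    · refine mul_ne_zero (by simpa using hτ) ?_
      simp [smallBallConst]
  have hn0 : 0 < ‖n‖ := norm_pos_iff.2 hn
  set e : EuclideanSpace ℂ ι := ((‖n‖⁻¹ : ℝ) : ℂ) • n with he
  have he1 : ‖e‖ = 1 := by
    rw [he, norm_smul, Complex.norm_real, norm_inv, norm_norm, inv_mul_cancel₀ hn0.ne']
  have hs : 0 < τ * ‖n‖⁻¹ := by positivity
  set f : (ι → ℂ) → ℝ≥0∞ := fun a => ENNReal.ofReal (τ * ‖n‖⁻¹) *
    (‖(WithLp.toLp 2 a : EuclideanSpace ℂ ι)‖ₑ ^ (6 : ℝ)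
      + ‖(inner ℂ e (WithLp.toLp 2 a) : ℂ)‖ₑ ^ (-(3 / 2) : ℝ)) with hf
  have hmeas : Measurable fun a : ι → ℂ => (inner ℂ e (WithLp.toLp 2 a) : ℂ) := by fun_prop
  have hfm : Measurable f := by
    rw [hf]; fun_prop
  calc _ ≤ stdComplexGaussian ι {a | 1 ≤ f a} := by
        refine measure_mono fun a ha => ?_
        have h1 : ‖(inner ℂ e (WithLp.toLp 2 a) : ℂ)‖ ≤ τ * ‖n‖⁻¹ *
            ‖(WithLp.toLp 2 a : EuclideanSpace ℂ ι)‖ ^ 2 := by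
          rw [he, inner_smul_left, norm_mul, Complex.conj_ofReal, Complex.norm_real, norm_inv,
            norm_norm, mul_comm τ, mul_assoc]
          exact mul_le_mul_of_nonneg_left ha (by positivity)
        have := one_le_of_le_mul_sq (norm_nonneg _) (norm_nonneg _) hs h1
        rwa [ofReal_norm, ofReal_norm] at this
    _ ≤ ∫⁻ a, f a ∂(stdComplexGaussian ι) := by
        simpa using mul_meas_ge_le_lintegral hfm 1 (μ := stdComplexGaussian ι)
    _ ≤ ENNReal.ofReal (τ * ‖n‖⁻¹) * smallBallConst ι := by
        rw [hf, lintegral_const_mul _ (by fun_prop), lintegral_add_left (by fun_prop),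
          smallBallConst, ← stdComplexGaussian_map_inner e he1, lintegral_map (by fun_prop) hmeas]
        gcongr
        exact le_add_self
    _ = _ := by
        rw [ENNReal.ofReal_mul hτ.le, ENNReal.ofReal_inv_of_pos hn0, ofReal_norm]
        ring

/-- Complex Gaussian vectors in dimension at least `m` have finite inverse moments of order `m`. -/
lemma lintegral_enorm_inv_pow_le {ι : Type*} [Fintype ι] {m : ℕ} (hm : m ≤ Fintype.card ι) :
    ∫⁻ n, (‖(WithLp.toLp 2 n : EuclideanSpace ℂ ι)‖ₑ⁻¹) ^ m ∂(stdComplexGaussian ι)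
      ≤ (1 + ∫⁻ z, ‖z‖ₑ⁻¹ ∂(USK.complexGaussian 1)) ^ Fintype.card ι := by
  calc _ ≤ ∫⁻ n : ι → ℂ, ∏ k, (1 + ‖n k‖ₑ⁻¹) ∂(stdComplexGaussian ι) := by
        refine lintegral_mono fun n => ?_
        have h1 : ∀ k, ‖(WithLp.toLp 2 n : EuclideanSpace ℂ ι)‖ₑ⁻¹ ≤ ‖n k‖ₑ⁻¹ := fun k => by
          rw [ENNReal.inv_le_inv]
          exact enorm_le_iff_norm_le.2 (PiLp.norm_apply_le (WithLp.toLp 2 n : EuclideanSpace ℂ ι) k)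
        calc _ ≤ (1 + ‖(WithLp.toLp 2 n : EuclideanSpace ℂ ι)‖ₑ⁻¹) ^ m := by
              gcongr; exact le_add_self
          _ ≤ (1 + ‖(WithLp.toLp 2 n : EuclideanSpace ℂ ι)‖ₑ⁻¹) ^ Fintype.card ι :=
              pow_le_pow_right₀ le_self_add hm
          _ = ∏ k : ι, (1 + ‖(WithLp.toLp 2 n : EuclideanSpace ℂ ι)‖ₑ⁻¹) := by simp
          _ ≤ _ := Finset.prod_le_prod' fun k _ => by exact add_le_add le_rfl (h1 k)
    _ = _ := by
        rw [stdComplexGaussian, lintegral_pi_prod (fun _ : ι => USK.complexGaussian 1)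
          (f := fun _ z => 1 + ‖z‖ₑ⁻¹) fun _ => by fun_prop]
        rw [lintegral_add_left measurable_const]
        simp

lemma lintegral_enorm_inv_lt_top : ∫⁻ z, ‖z‖ₑ⁻¹ ∂(USK.complexGaussian 1) < ∞ := by
  refine lt_of_le_of_lt (b := ∫⁻ z, (1 + ‖z‖ₑ ^ (-(3 / 2) : ℝ)) ∂(USK.complexGaussian 1))
    (lintegral_mono fun z => ?_) ?_
  · rw [ENNReal.rpow_neg]
    rcases le_total 1 ‖z‖ₑ with h | h
    · exact (ENNReal.inv_le_one.2 h).trans le_self_add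
    · refine le_trans ?_ le_add_self
      rw [ENNReal.inv_le_inv]
      simpa using ENNReal.rpow_le_rpow_of_exponent_ge h (show (1 : ℝ) ≤ 3 / 2 by norm_num)
  · rw [lintegral_add_left measurable_const]
    simpa using lintegral_enorm_inv_complexGaussian_lt_top

/-- For independent Gaussian vectors `a j` and `n`, it is unlikely that all the `a j` are nearly
orthogonal to `n`. -/
lemma pi_stdComplexGaussian_inner_le (ι κ : Type*) [Fintype ι] [Fintype κ]
    {m : ℕ} (hmι : m ≤ Fintype.card ι) (hmκ : m ≤ Fintype.card κ)
    {τ : ℝ} (hτ : 0 < τ) :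
    (Measure.pi fun _ : Option κ => stdComplexGaussian ι)
        {x | ∀ j : κ, ‖inner ℂ (WithLp.toLp 2 (x none) : EuclideanSpace ℂ ι)
            (WithLp.toLp 2 (x (some j)))‖
          ≤ τ * ‖(WithLp.toLp 2 (x (some j)) : EuclideanSpace ℂ ι)‖ ^ 2}
      ≤ (ENNReal.ofReal τ * smallBallConst ι) ^ m *
        (1 + ∫⁻ z, ‖z‖ₑ⁻¹ ∂(USK.complexGaussian 1)) ^ Fintype.card ι := by
  have hS : MeasurableSet {x : Option κ → ι → ℂ | ∀ j : κ,
      ‖inner ℂ (WithLp.toLp 2 (x none) : EuclideanSpace ℂ ι) (WithLp.toLp 2 (x (some j)))‖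
        ≤ τ * ‖(WithLp.toLp 2 (x (some j)) : EuclideanSpace ℂ ι)‖ ^ 2} := by
    rw [Set.ofPred_forall]
    refine MeasurableSet.iInter fun j => measurableSet_le ?_ ?_ <;> fun_prop
  rw [← Measure.pi_map_piOptionEquivProd, Measure.map_apply (by fun_prop) hS,
    Measure.prod_apply_symm ((MeasurableEquiv.measurable _) hS)]
  calc _ ≤ ∫⁻ n, (ENNReal.ofReal τ * smallBallConst ι) ^ m *
        ((‖(WithLp.toLp 2 n : EuclideanSpace ℂ ι)‖ₑ⁻¹) ^ m) ∂(stdComplexGaussian ι) := by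
        refine lintegral_mono fun n => ?_
        set T : Set (ι → ℂ) := {a | ‖inner ℂ (WithLp.toLp 2 n) (WithLp.toLp 2 a)‖
          ≤ τ * ‖(WithLp.toLp 2 a : EuclideanSpace ℂ ι)‖ ^ 2} with hT
        calc _ = (Measure.pi fun _ : κ => stdComplexGaussian ι) (Set.univ.pi fun _ => T) := by
              congr 1
              ext x
              simp only [Set.mem_preimage, Set.mem_ofPred_eq, Set.mem_univ_pi, hT]
              rfl
          _ = (stdComplexGaussian ι T) ^ Fintype.card κ := by rw [Measure.pi_pi]; simp
          _ ≤ (stdComplexGaussian ι T) ^ m := pow_le_pow_right_of_le_one' prob_le_one hmκ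
          _ ≤ _ := by
              rw [← mul_pow]
              exact pow_le_pow_left' (stdComplexGaussian_inner_le _ hτ) m
    _ ≤ _ := by
        rw [lintegral_const_mul _ (by fun_prop)]
        exact mul_le_mul' le_rfl (lintegral_enorm_inv_pow_le hmι)

/-- All columns of `A` are nearly orthogonal to `w`, in the sense that their inner products with
`w` are at most `τ` times their squared lengths. -/
def NearlyOrthogonal {m n : ℕ} (τ : ℝ) (A : Matrix (Fin m) (Fin n) ℂ) (w : Fin m → ℂ) : Prop :=
  ∀ j, ‖inner ℂ (WithLp.toLp 2 w : EuclideanSpace ℂ (Fin m)) (WithLp.toLp 2 fun k => A k j)‖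
    ≤ τ * USK.len (fun k => A k j) ^ 2

lemma leftBlock_conjTranspose_mul_leftBlock {NA NB : ℕ} (h : NB ≤ NA)
    {V : Matrix (Fin NA) (Fin NA) ℂ} (hV : V ∈ Matrix.unitaryGroup (Fin NA) ℂ) :
    (USK.leftBlock h V)ᴴ * USK.leftBlock h V = 1 := by
  have hV' : Vᴴ * V = 1 := Matrix.mem_unitaryGroup_iff'.1 hV
  ext i j
  have := congrFun (congrFun hV' (Fin.castLE h i)) (Fin.castLE h j)
  simp only [Matrix.mul_apply, Matrix.one_apply, Fin.ext_iff] at this ⊢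
  simpa [USK.leftBlock] using this

lemma leftBlock_conjTranspose_mul_rightBlock {NA NB : ℕ} (h : NB ≤ NA)
    {V : Matrix (Fin NA) (Fin NA) ℂ} (hV : V ∈ Matrix.unitaryGroup (Fin NA) ℂ) :
    (USK.leftBlock h V)ᴴ * USK.rightBlock h V = 0 := by
  have hV' : Vᴴ * V = 1 := Matrix.mem_unitaryGroup_iff'.1 hV
  ext i j
  have := congrFun (congrFun hV' (Fin.castLE h i)) ⟨NB + j, by omega⟩
  simp only [Matrix.mul_apply, Matrix.one_apply, Fin.ext_iff] at this ⊢
  rw [if_neg (by simp; omega)] at this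
  simpa [USK.leftBlock, USK.rightBlock] using this

lemma rightBlock_conjTranspose_mul_rightBlock {NA NB : ℕ} (h : NB ≤ NA)
    {V : Matrix (Fin NA) (Fin NA) ℂ} (hV : V ∈ Matrix.unitaryGroup (Fin NA) ℂ) :
    (USK.rightBlock h V)ᴴ * USK.rightBlock h V = 1 := by
  have hV' : Vᴴ * V = 1 := Matrix.mem_unitaryGroup_iff'.1 hV
  ext i j
  have := congrFun (congrFun hV' ⟨NB + i, by omega⟩) ⟨NB + j, by omega⟩
  simp only [Matrix.mul_apply, Matrix.one_apply, Fin.ext_iff] at this ⊢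
  simpa [USK.rightBlock] using this

lemma star_dotProduct_self {n : ℕ} (x : Fin n → ℂ) : star x ⬝ᵥ x = ((USK.len x ^ 2 : ℝ) : ℂ) := by
  rw [dotProduct_comm, USK.len]
  have := inner_self_eq_norm_sq_to_K (𝕜 := ℂ) (WithLp.toLp 2 x : EuclideanSpace ℂ (Fin n))
  rw [EuclideanSpace.inner_eq_star_dotProduct] at this
  simpa using this

lemma measurable_len {n : ℕ} : Measurable (USK.len : (Fin n → ℂ) → ℝ) := by
  unfold USK.len; fun_prop

lemma pi_stdComplexGaussian_nearlyOrthogonal_le {NA NB : ℕ} (NE : ℕ) (h : NB ≤ NA)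
    {V : Matrix (Fin NA) (Fin NA) ℂ} (hV : V ∈ Matrix.unitaryGroup (Fin NA) ℂ)
    {e : Fin (NA - NB) → ℂ} (he : USK.len e = 1) {m : ℕ} (hmE : m ≤ NE) (hmB : m ≤ NB)
    {τ : ℝ} (hτ : 0 < τ) :
    (Measure.pi fun _ : Fin NE => stdComplexGaussian (Fin NA))
        {G | NearlyOrthogonal τ (Matrix.of G * USK.leftBlock h V)
          ((Matrix.of G * USK.rightBlock h V) *ᵥ e)}
      ≤ (ENNReal.ofReal τ * smallBallConst (Fin NE)) ^ m *
        (1 + ∫⁻ z, ‖z‖ₑ⁻¹ ∂(USK.complexGaussian 1)) ^ NE := by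
  set Q : Matrix (Fin NA) (Option (Fin NB)) ℂ := Matrix.of fun i o =>
    o.elim ((USK.rightBlock h V *ᵥ e) i) (fun j => USK.leftBlock h V i j) with hQdef
  have hLR : (USK.leftBlock h V)ᴴ *ᵥ (USK.rightBlock h V *ᵥ e) = 0 := by
    rw [Matrix.mulVec_mulVec, leftBlock_conjTranspose_mul_rightBlock h hV, Matrix.zero_mulVec]
  have hLR' : ∀ j, ∑ i, star (USK.leftBlock h V i j) * (USK.rightBlock h V *ᵥ e) i = 0 :=
    fun j => congrFun hLR j
  have hRR : star (USK.rightBlock h V *ᵥ e) ⬝ᵥ (USK.rightBlock h V *ᵥ e) = 1 := by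
    rw [Matrix.star_mulVec, Matrix.dotProduct_mulVec, Matrix.vecMul_vecMul,
      rightBlock_conjTranspose_mul_rightBlock h hV, Matrix.vecMul_one, star_dotProduct_self, he]
    simp
  have hQ : Qᴴ * Q = 1 := by
    ext a b
    rcases a with _ | a <;> rcases b with _ | b
    · simpa [Matrix.mul_apply, hQdef, dotProduct] using hRR
    · simpa [Matrix.mul_apply, hQdef, mul_comm] using congrArg star (hLR' b)
    · simpa [Matrix.mul_apply, hQdef] using hLR' a
    · have := congrFun (congrFun (leftBlock_conjTranspose_mul_leftBlock h hV) a) b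
      simpa [Matrix.mul_apply, hQdef, Matrix.one_apply] using this
  have hlaw : (Measure.pi fun _ : Fin NE => stdComplexGaussian (Fin NA)).map
      (fun G o k => (G k ᵥ* Q) o) = Measure.pi fun _ : Option (Fin NB) =>
        stdComplexGaussian (Fin NE) := by
    have h1 := Measure.pi_map_pi (μ := fun _ : Fin NE => stdComplexGaussian (Fin NA))
      (f := fun _ x => x ᵥ* Q) (fun _ => (measurable_vecMul Q).aemeasurable)
    rw [← pi_stdComplexGaussian_map_swap (Fin NE) (Option (Fin NB))]
    simp only [stdComplexGaussian_map_vecMul Q hQ] at h1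
    rw [← h1, Measure.map_map (by fun_prop)]
    · rfl
    · exact measurable_pi_lambda _ fun k => (measurable_vecMul Q).comp (measurable_pi_apply k)
  have hmeas : Measurable fun (G : Fin NE → Fin NA → ℂ) (o : Option (Fin NB)) (k : Fin NE) =>
      (G k ᵥ* Q) o := by
    refine measurable_pi_lambda _ fun o => measurable_pi_lambda _ fun k => ?_
    exact (measurable_pi_apply o).comp ((measurable_vecMul Q).comp (measurable_pi_apply k))
  have key := pi_stdComplexGaussian_inner_le (Fin NE) (Fin NB) (m := m) (by simpa using hmE)
    (by simpa using hmB) hτ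
  rw [← hlaw, Fintype.card_fin] at key
  refine le_trans (le_trans (le_of_eq ?_) (Measure.le_map_apply hmeas.aemeasurable _)) key
  congr 1
  ext G
  have hn : (Matrix.of G * USK.rightBlock h V) *ᵥ e = fun k => (G k ᵥ* Q) none := by
    funext k
    rw [← Matrix.mulVec_mulVec]
    simp [Matrix.mulVec, Matrix.vecMul, dotProduct, hQdef]
  have hs : ∀ j, (fun k => (Matrix.of G * USK.leftBlock h V) k j) = fun k => (G k ᵥ* Q) (some j) := by
    intro j; funext k
    simp [Matrix.mul_apply, Matrix.vecMul, dotProduct, hQdef]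
  simp only [Set.mem_ofPred_eq, Set.mem_preimage, NearlyOrthogonal, hn, hs, USK.len]

/-- Over independent pairs `(X i, U i)` with an independent family `V`, the probability that
every `i` has `U i ∈ D` or `(X i, V i) ∈ E i` is at most `(α + β) ^ n`, if `U i ∈ D` has probability
at most `α` and `(X i, v) ∈ E i` has probability at most `β` for each fixed `v`. -/
lemma measure_forall_or_le {n : ℕ} {Ω 𝒳 𝒰 𝒱 : Type*} [MeasurableSpace Ω] [MeasurableSpace 𝒳]
    [MeasurableSpace 𝒰] [MeasurableSpace 𝒱] {μ : Measure Ω} [IsProbabilityMeasure μ]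
    {X : Fin n → Ω → 𝒳} {U : Fin n → Ω → 𝒰} {V : Fin n → Ω → 𝒱}
    (hXm : ∀ i, Measurable (X i)) (hUm : ∀ i, Measurable (U i)) (hVm : ∀ i, Measurable (V i))
    (hX : iIndepFun X μ) (hU : iIndepFun U μ)
    (hUV : IndepFun (fun ω i => U i ω) (fun ω i => V i ω) μ)
    (hXUV : IndepFun (fun ω i => X i ω) (fun ω => ((fun i => U i ω), (fun i => V i ω))) μ)
    {D : Set 𝒰} (hD : MeasurableSet D) {E : Fin n → Set (𝒳 × 𝒱)} (hE : ∀ i, MeasurableSet (E i))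
    {α β : ℝ≥0∞} (hα : ∀ i, μ.map (U i) D ≤ α)
    (hβ : ∀ i v, μ.map (X i) {x | (x, v) ∈ E i} ≤ β) :
    μ {ω | ∀ i, U i ω ∈ D ∨ (X i ω, V i ω) ∈ E i} ≤ (α + β) ^ n := by
  have hXm' : Measurable fun ω i => X i ω := measurable_pi_lambda _ hXm
  have hUm' : Measurable fun ω i => U i ω := measurable_pi_lambda _ hUm
  have hVm' : Measurable fun ω i => V i ω := measurable_pi_lambda _ hVm
  have := fun i => Measure.isProbabilityMeasure_map (μ := μ) (hXm i).aemeasurable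
  have := fun i => Measure.isProbabilityMeasure_map (μ := μ) (hUm i).aemeasurable
  have := Measure.isProbabilityMeasure_map (μ := μ) hVm'.aemeasurable
  set S : Set ((Fin n → 𝒳) × (Fin n → 𝒰) × (Fin n → 𝒱)) :=
    {p | ∀ i, p.2.1 i ∈ D ∨ (p.1 i, p.2.2 i) ∈ E i} with hS
  have hSm : MeasurableSet S := by
    rw [hS, Set.ofPred_forall]
    refine MeasurableSet.iInter fun i => MeasurableSet.union ?_ ?_
    · exact (show Measurable fun p : (Fin n → 𝒳) × (Fin n → 𝒰) × (Fin n → 𝒱) => p.2.1 i by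
        fun_prop) hD
    · exact (show Measurable fun p : (Fin n → 𝒳) × (Fin n → 𝒰) × (Fin n → 𝒱) =>
        (p.1 i, p.2.2 i) by fun_prop) (hE i)
  have hlaw : μ.map (fun ω => ((fun i => X i ω), ((fun i => U i ω), (fun i => V i ω))))
      = (Measure.pi fun i => μ.map (X i)).prod
        ((Measure.pi fun i => μ.map (U i)).prod (μ.map fun ω i => V i ω)) := by
    rw [(indepFun_iff_map_prod_eq_prod_map_map hXm'.aemeasurable
        (hUm'.prodMk hVm').aemeasurable).1 hXUV,
      (indepFun_iff_map_prod_eq_prod_map_map hUm'.aemeasurable hVm'.aemeasurable).1 hUV,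
      (iIndepFun_iff_map_fun_eq_pi_map fun i => (hXm i).aemeasurable).1 hX,
      (iIndepFun_iff_map_fun_eq_pi_map fun i => (hUm i).aemeasurable).1 hU]
  have hfm : ∀ i : Fin n, Measurable fun x : 𝒰 => D.indicator (1 : 𝒰 → ℝ≥0∞) x + β := fun i =>
    (measurable_one.indicator hD).add_const _
  calc μ {ω | ∀ i, U i ω ∈ D ∨ (X i ω, V i ω) ∈ E i}
      = (μ.map (fun ω => ((fun i => X i ω), ((fun i => U i ω), (fun i => V i ω))))) S := by
        rw [Measure.map_apply (hXm'.prodMk (hUm'.prodMk hVm')) hSm]; rfl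
    _ ≤ ∫⁻ q, ∏ i, (D.indicator (1 : 𝒰 → ℝ≥0∞) (q.1 i) + β)
        ∂((Measure.pi fun i => μ.map (U i)).prod (μ.map fun ω i => V i ω)) := by
        rw [hlaw, Measure.prod_apply_symm hSm]
        refine lintegral_mono fun q => ?_
        have hpre : (fun x => (x, q)) ⁻¹' S
            = Set.univ.pi fun i => {x | q.1 i ∈ D ∨ (x, q.2 i) ∈ E i} := by
          ext x; simp [hS]
        rw [hpre, Measure.pi_pi]
        refine Finset.prod_le_prod' fun i _ => ?_
        by_cases hq : q.1 i ∈ D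
        · simp only [Set.indicator_of_mem hq, Pi.one_apply]
          exact prob_le_one.trans le_self_add
        · simpa [hq] using hβ i (q.2 i)
    _ = ∏ i, ∫⁻ x, (D.indicator (1 : 𝒰 → ℝ≥0∞) x + β) ∂(μ.map (U i)) := by
        rw [lintegral_prod _ (by fun_prop)]
        simp only [lintegral_const, measure_univ, mul_one]
        exact lintegral_pi_prod (fun i => μ.map (U i)) hfm
    _ ≤ ∏ _i : Fin n, (α + β) := by
        refine Finset.prod_le_prod' fun i _ => ?_
        rw [lintegral_add_right _ measurable_const, lintegral_indicator_one hD]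
        simpa using add_le_add_left (hα i) β
    _ = _ := by simp

/-- The constellation `qam M` as a finset. -/
noncomputable def qamFinset (M : ℕ) : Finset ℂ :=
  (Finset.range (Nat.sqrt M) ×ˢ Finset.range (Nat.sqrt M)).image
    fun p => (p.1 : ℂ) + (p.2 : ℂ) * Complex.I

lemma natCast_add_natCast_mul_I_injective :
    Function.Injective fun p : ℕ × ℕ => (p.1 : ℂ) + (p.2 : ℂ) * Complex.I := by
  rintro ⟨a, b⟩ ⟨c, d⟩ h
  have h1 := congrArg Complex.re h
  have h2 := congrArg Complex.im h
  simp at h1 h2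
  simp [h1, h2]

lemma coe_qamFinset (M : ℕ) : (qamFinset M : Set ℂ) = USK.qam M := by
  ext z
  simp only [qamFinset, USK.qam, Finset.coe_image, Set.mem_image, Finset.mem_coe,
    Finset.mem_product, Finset.mem_range, Prod.exists, Set.mem_ofPred_eq]
  exact ⟨fun ⟨a, b, h, hz⟩ => ⟨a, b, h.1, h.2, hz.symm⟩,
    fun ⟨a, b, h1, h2, hz⟩ => ⟨a, b, ⟨h1, h2⟩, hz.symm⟩⟩

lemma mem_qamFinset {M : ℕ} {z : ℂ} : z ∈ qamFinset M ↔ z ∈ USK.qam M := by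
  rw [← coe_qamFinset, Finset.mem_coe]

lemma card_qamFinset (M : ℕ) : (qamFinset M).card = Nat.sqrt M * Nat.sqrt M := by
  rw [qamFinset, Finset.card_image_of_injective _ natCast_add_natCast_mul_I_injective]
  simp

lemma coe_piFinset_qamFinset (M n : ℕ) :
    (Fintype.piFinset (fun _ : Fin n => qamFinset M) : Set (Fin n → ℂ)) = USK.qamVec M n := by
  ext x
  simp [USK.qamVec, mem_qamFinset]

lemma finite_qamVec (M n : ℕ) : (USK.qamVec M n).Finite := by
  rw [← coe_piFinset_qamFinset]; exact Finset.finite_toSet _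

lemma finite_finiteLattice {m n : ℕ} (A : Matrix (Fin m) (Fin n) ℂ) (M : ℕ) :
    (USK.finiteLattice A M).Finite := (finite_qamVec M n).image _

/-- The vectors that leave the constellation by a step of less than `d` units in one coordinate,
in one of the directions `1, I, -1, -I`. -/
def nearBoundary (M n d : ℕ) : Set (Fin n → ℂ) :=
  {x | ∃ j : Fin n, ∃ k : Fin d, ∃ l : Fin 4,
    x + Pi.single j ((k : ℕ) * Complex.I ^ (l : ℕ)) ∉ USK.qamVec M n}

lemma measurableSet_nearBoundary (M n d : ℕ) : MeasurableSet (nearBoundary M n d) := by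
  simp only [nearBoundary, Set.ofPred_exists]
  refine MeasurableSet.iUnion fun j => MeasurableSet.iUnion fun k => MeasurableSet.iUnion fun l => ?_
  exact (measurable_id.add_const _) (finite_qamVec M n).measurableSet.compl

/-- The points of the constellation at distance at most `d` from its boundary. -/
noncomputable def qamBoundary (M d : ℕ) : Finset ℂ :=
  ((Finset.range (Nat.sqrt M) ×ˢ Finset.range (Nat.sqrt M)).filter
      fun p => p.1 < d ∨ Nat.sqrt M ≤ p.1 + d ∨ p.2 < d ∨ Nat.sqrt M ≤ p.2 + d).image
    fun p => (p.1 : ℂ) + (p.2 : ℂ) * Complex.I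

lemma card_qamBoundary_le (M d : ℕ) : (qamBoundary M d).card ≤ 4 * d * Nat.sqrt M := by
  set s := Nat.sqrt M
  refine Finset.card_image_le.trans ?_
  calc _ ≤ ((Finset.range d ×ˢ Finset.range s) ∪ (Finset.Ico (s - d) s ×ˢ Finset.range s) ∪
        (Finset.range s ×ˢ Finset.range d) ∪ (Finset.range s ×ˢ Finset.Ico (s - d) s)).card := by
        refine Finset.card_le_card fun p hp => ?_
        simp only [Finset.mem_filter, Finset.mem_product, Finset.mem_range, Finset.mem_union,
          Finset.mem_Ico] at hp ⊢
        omega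
    _ ≤ d * s + d * s + s * d + s * d := by
        refine (Finset.card_union_le _ _).trans (add_le_add ((Finset.card_union_le _ _).trans
          (add_le_add ((Finset.card_union_le _ _).trans (add_le_add ?_ ?_)) ?_)) ?_) <;>
        simp only [Finset.card_product, Finset.card_range, Nat.card_Ico] <;> gcongr <;> omega
    _ = _ := by ring

lemma mem_qamBoundary_of_mem_nearBoundary {M n d : ℕ} {x : Fin n → ℂ} (hx : x ∈ USK.qamVec M n)
    (hb : x ∈ nearBoundary M n d) : ∃ j, x j ∈ qamBoundary M d := by
  obtain ⟨j, k, l, h⟩ := hb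
  refine ⟨j, ?_⟩
  by_contra hj
  refine h fun i => ?_
  rcases eq_or_ne i j with rfl | hij
  · obtain ⟨a, b, ha, hb, hab⟩ := hx i
    have hnot : ¬ (a < d ∨ Nat.sqrt M ≤ a + d ∨ b < d ∨ Nat.sqrt M ≤ b + d) := fun hn =>
      hj (Finset.mem_image.2 ⟨(a, b), by simpa [ha, hb] using hn, hab.symm⟩)
    push Not at hnot
    have hk := k.2
    simp only [Pi.add_apply, Pi.single_eq_same, hab]
    fin_cases l
    · exact ⟨a + k, b, by omega, by omega, by push_cast; simp; ring⟩
    · exact ⟨a, b + k, by omega, by omega, by push_cast; simp; ring⟩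
    · refine ⟨a - k, b, by omega, by omega, ?_⟩
      rw [Nat.cast_sub (by omega)]; simp; ring
    · refine ⟨a, b - k, by omega, by omega, ?_⟩
      rw [Nat.cast_sub (by omega)]
      simp [pow_succ]; ring
  · simpa [Pi.single_eq_of_ne hij] using hx i

lemma uniformOn_qamVec_nearBoundary_le {M : ℕ} (hM : 0 < M) (n d : ℕ) :
    uniformOn (USK.qamVec M n) (nearBoundary M n d)
      ≤ n * ((4 * d : ℕ) / (Nat.sqrt M : ℝ≥0∞)) := by
  classical
  have hs : 0 < Nat.sqrt M := Nat.sqrt_pos.2 hM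
  set T : Fin n → Finset (Fin n → ℂ) := fun j =>
    Fintype.piFinset (Function.update (fun _ => qamFinset M) j (qamBoundary M d)) with hT
  have hsub : USK.qamVec M n ∩ nearBoundary M n d ⊆ ⋃ j, (T j : Set (Fin n → ℂ)) := by
    rintro x ⟨hx, hb⟩
    obtain ⟨j, hj⟩ := mem_qamBoundary_of_mem_nearBoundary hx hb
    refine Set.mem_iUnion.2 ⟨j, ?_⟩
    simp only [hT, Finset.mem_coe, Fintype.mem_piFinset]
    intro i
    rcases eq_or_ne i j with rfl | hij
    · simpa using hj
    · simpa [hij] using mem_qamFinset.2 (hx i)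
  rw [← uniformOn_inter_self (finite_qamVec M n)]
  refine (measure_mono hsub).trans ((measure_iUnion_fintype_le _ _).trans ?_)
  have hj : ∀ j, uniformOn (USK.qamVec M n) (T j : Set (Fin n → ℂ))
      ≤ (4 * d : ℕ) / (Nat.sqrt M : ℝ≥0∞) := by
    intro j
    rw [← coe_piFinset_qamFinset, uniformOn_apply_finset]
    have hc : (T j).card = (qamBoundary M d).card * (Nat.sqrt M * Nat.sqrt M) ^ (n - 1) := by
      rw [hT, Fintype.card_piFinset, ← Finset.mul_prod_erase _ _ (Finset.mem_univ j)]
      congr 1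
      · simp
      · rw [Finset.prod_congr rfl (g := fun _ => Nat.sqrt M * Nat.sqrt M)]
        · simp
        · intro i hi
          rw [Function.update_of_ne (Finset.ne_of_mem_erase hi), card_qamFinset]
    have hS : (Fintype.piFinset fun _ : Fin n => qamFinset M).card
        = (Nat.sqrt M * Nat.sqrt M) * (Nat.sqrt M * Nat.sqrt M) ^ (n - 1) := by
      rw [Fintype.card_piFinset_const, card_qamFinset, ← pow_succ',
        Nat.sub_add_cancel (Fin.pos j)]
    have hle : ((Fintype.piFinset fun _ : Fin n => qamFinset M) ∩ T j).card
        ≤ (4 * d) * (Nat.sqrt M * (Nat.sqrt M * Nat.sqrt M) ^ (n - 1)) := by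
      refine (Finset.card_le_card Finset.inter_subset_right).trans ?_
      rw [hc, ← mul_assoc]
      exact Nat.mul_le_mul_right _ (card_qamBoundary_le M d)
    rw [hS, mul_assoc]
    obtain ⟨r, hr⟩ : ∃ r, r = Nat.sqrt M * (Nat.sqrt M * Nat.sqrt M) ^ (n - 1) := ⟨_, rfl⟩
    have hr0 : r ≠ 0 := by rw [hr]; positivity
    rw [← hr] at hle ⊢
    calc _ ≤ (((4 * d) * r : ℕ) : ℝ≥0∞) / ((Nat.sqrt M * r : ℕ) : ℝ≥0∞) := by gcongr
      _ = _ := by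
          rw [Nat.cast_mul (4 * d), Nat.cast_mul (Nat.sqrt M)]
          exact ENNReal.mul_div_mul_right _ _ (by exact_mod_cast hr0) (ENNReal.natCast_ne_top _)
  calc _ ≤ ∑ _j : Fin n, (4 * d : ℕ) / (Nat.sqrt M : ℝ≥0∞) := Finset.sum_le_sum fun j _ => hj j
    _ = _ := by simp

lemma norm_sub_smul_le {E : Type*} [NormedAddCommGroup E] [InnerProductSpace ℂ E] {x y : E}
    (h : ‖x‖ ^ 2 ≤ (inner ℂ y x : ℂ).re) {s : ℝ} (hs0 : 0 ≤ s) (hs1 : s ≤ 1) :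
    ‖x - (s : ℂ) • y‖ ≤ ‖y‖ := by
  have h1 : ‖x‖ ^ 2 ≤ ‖y‖ * ‖x‖ :=
    h.trans ((Complex.re_le_norm _).trans (norm_inner_le_norm y x))
  have hx : ‖x‖ ≤ ‖y‖ := by
    rcases (norm_nonneg x).eq_or_lt with h0 | h0
    · rw [← h0]; exact norm_nonneg y
    · nlinarith
  have hxy : ‖x - y‖ ≤ ‖y‖ := by
    have h2 : ‖x - y‖ ^ 2 = ‖x‖ ^ 2 - 2 * (inner ℂ y x : ℂ).re + ‖y‖ ^ 2 := by
      rw [norm_sub_rev, norm_sub_sq (𝕜 := ℂ)]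
      simp only [RCLike.re_to_complex]
      ring
    have h3 := norm_nonneg x
    exact abs_le_of_sq_le_sq' (by nlinarith [sq_nonneg ‖x‖]) (norm_nonneg y) |>.2
  have h4 : x - (s : ℂ) • y = ((1 - s : ℝ) : ℂ) • x + (s : ℂ) • (x - y) := by
    push_cast
    module
  rw [h4]
  refine (norm_add_le _ _).trans ?_
  rw [norm_smul, norm_smul, Complex.norm_real, Complex.norm_real, Real.norm_of_nonneg hs0,
    Real.norm_of_nonneg (by linarith)]
  nlinarith

lemma exists_half_norm_le_re (c : ℂ) : ∃ l : Fin 4, ‖c‖ / 2 ≤ (Complex.I ^ (l : ℕ) * c).re := by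
  have h := Complex.norm_le_abs_re_add_abs_im c
  rcases le_total |c.re| |c.im| with h1 | h1
  · rcases abs_cases c.im with ⟨h2, -⟩ | ⟨h2, -⟩
    · exact ⟨3, by simp [pow_succ]; linarith⟩
    · exact ⟨1, by simp; linarith⟩
  · rcases abs_cases c.re with ⟨h2, -⟩ | ⟨h2, -⟩
    · exact ⟨0, by simp; linarith⟩
    · exact ⟨2, by simp; linarith⟩

lemma len_smul {n : ℕ} (c : ℂ) (x : Fin n → ℂ) : USK.len (c • x) = ‖c‖ * USK.len x := by
  rw [USK.len, USK.len, WithLp.toLp_smul, norm_smul]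

lemma len_mulVec_le_Rmax {m n : ℕ} (W : Matrix (Fin m) (Fin n) ℂ) {Pv : ℝ} {v : Fin n → ℂ}
    (hv : v ∈ USK.keySet n Pv) : USK.len (W *ᵥ v) ≤ USK.Rmax W Pv := by
  refine le_csSup ?_ ⟨v, hv, rfl⟩
  set T := (Matrix.toEuclideanLin W).toContinuousLinearMap with hT
  refine ⟨‖T‖ * √Pv, ?_⟩
  rintro _ ⟨x, hx, rfl⟩
  have h1 : USK.len (W *ᵥ x) = ‖T (WithLp.toLp 2 x)‖ := by
    simp [hT, USK.len]
  have h2 : USK.len x ≤ √Pv := Real.le_sqrt_of_sq_le hx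
  change USK.len (W *ᵥ x) ≤ _
  rw [h1]
  exact (T.le_opNorm _).trans (mul_le_mul_of_nonneg_left h2 (norm_nonneg _))

/-- If some column of `A` is not nearly orthogonal to the direction of the noise, and `u` is not
near the boundary, then many lattice points lie in the ball. -/
lemma le_ncard_ball_inter_finiteLattice {NE NB K M d : ℕ} {Pv : ℝ} (hPv : 0 < Pv)
    {A : Matrix (Fin NE) (Fin NB) ℂ} {W : Matrix (Fin NE) (Fin K) ℂ} {u : Fin NB → ℂ}
    {v e : Fin K → ℂ} (hu : u ∉ nearBoundary M NB d) (hv : v ∈ USK.keySet K Pv)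
    (he : USK.len e = 1) (hve : v = (USK.len v : ℂ) • e)
    (hno : ¬ NearlyOrthogonal (2 * d / √Pv) A (W *ᵥ e)) :
    d ≤ (USK.ball (A *ᵥ u + W *ᵥ v) (USK.Rmax W Pv) ∩ USK.finiteLattice A M).ncard := by
  have hr : 0 < √Pv := Real.sqrt_pos.2 hPv
  simp only [NearlyOrthogonal, not_forall, not_le] at hno
  obtain ⟨j, hj⟩ := hno
  set a : Fin NE → ℂ := fun k => A k j with ha
  set w : EuclideanSpace ℂ (Fin NE) := WithLp.toLp 2 (W *ᵥ e) with hw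
  obtain ⟨l, hl⟩ := exists_half_norm_le_re (inner ℂ w (WithLp.toLp 2 a))
  have ha0 : a ≠ 0 := by
    intro h0
    rw [h0] at hj
    simp [USK.len] at hj
  have hstep : ∀ k : ℕ, A *ᵥ (u + Pi.single j (k * Complex.I ^ (l : ℕ)))
      = A *ᵥ u + (k * Complex.I ^ (l : ℕ)) • a := by
    intro k
    rw [Matrix.mulVec_add, Matrix.mulVec_single]
    congr 1
    ext i
    simp [ha, mul_comm]
  have hkey : ((√Pv : ℝ) : ℂ) • e ∈ USK.keySet K Pv := by
    change USK.len _ ^ 2 ≤ Pv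
    rw [len_smul, he, Complex.norm_real, Real.norm_of_nonneg hr.le, mul_one, Real.sq_sqrt hPv.le]
  have hRm := len_mulVec_le_Rmax W hkey
  refine Set.le_ncard_of_inj_on_range
    (fun k => A *ᵥ (u + Pi.single j (k * Complex.I ^ (l : ℕ)))) ?_ ?_
    ((finite_finiteLattice A M).subset Set.inter_subset_right)
  · intro k hk
    refine ⟨?_, ⟨_, ?_, rfl⟩⟩
    · change USK.len _ ≤ _
      refine le_trans ?_ hRm
      have hs0 : 0 ≤ USK.len v / √Pv := div_nonneg (norm_nonneg _) hr.le
      have hs1 : USK.len v / √Pv ≤ 1 := (div_le_one hr).2 (Real.le_sqrt_of_sq_le hv)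
      have hx : ‖((k * Complex.I ^ (l : ℕ)) • WithLp.toLp 2 a : EuclideanSpace ℂ (Fin NE))‖ ^ 2
          ≤ (inner ℂ (((√Pv : ℝ) : ℂ) • w)
            ((k * Complex.I ^ (l : ℕ)) • WithLp.toLp 2 a : EuclideanSpace ℂ (Fin NE)) : ℂ).re := by
        rw [norm_smul, inner_smul_left, inner_smul_right, Complex.conj_ofReal, Complex.re_ofReal_mul,
          mul_assoc, ← Complex.ofReal_natCast, Complex.re_ofReal_mul]
        simp only [norm_mul, norm_pow, Complex.norm_I, one_pow, mul_one, Complex.norm_real,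
          Real.norm_natCast]
        change _ < ‖inner ℂ w (WithLp.toLp 2 a)‖ at hj
        change (k * USK.len a) ^ 2 ≤ _
        have h1 : (2 * d) * USK.len a ^ 2 ≤ √Pv * ‖inner ℂ w (WithLp.toLp 2 a)‖ := by
          have := mul_le_mul_of_nonneg_left hj.le hr.le
          refine le_trans (le_of_eq ?_) this
          field_simp
        have hkd : (k : ℝ) ≤ d := by exact_mod_cast hk.le
        have h2 := mul_le_mul_of_nonneg_left hl hr.le
        calc (k * USK.len a) ^ 2 = k * (k * USK.len a ^ 2) := by ring
          _ ≤ k * (d * USK.len a ^ 2) := by gcongr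
          _ ≤ k * (√Pv * (Complex.I ^ (l : ℕ) * inner ℂ w (WithLp.toLp 2 a)).re) := by
              refine mul_le_mul_of_nonneg_left ?_ (Nat.cast_nonneg k)
              linarith
          _ = _ := by ring
      have := norm_sub_smul_le hx hs0 hs1
      refine le_of_eq_of_le ?_ (this.trans_eq ?_)
      · rw [USK.len]
        congr 1
        have hWv : W *ᵥ v = (((USK.len v / √Pv : ℝ) : ℂ) * ((√Pv : ℝ) : ℂ)) • (W *ᵥ e) := by
          conv_lhs => rw [hve]
          rw [Matrix.mulVec_smul, ← Complex.ofReal_mul, div_mul_cancel₀ _ hr.ne']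
        rw [hstep, hWv, smul_smul, hw, add_sub_add_left_eq_sub]
        rfl
      · rw [USK.len, Matrix.mulVec_smul, WithLp.toLp_smul]
    · by_contra h
      exact hu ⟨j, ⟨k, hk⟩, l, h⟩
  · intro k _ k' _ h
    simp only [hstep] at h
    have h1 := smul_left_injective ℂ ha0 (add_left_cancel h)
    have h2 : Complex.I ^ (l : ℕ) ≠ 0 := pow_ne_zero _ Complex.I_ne_zero
    exact_mod_cast mul_right_cancel₀ h2 h1

lemma negMulLog_measureReal_nonneg {α : Type*} [MeasurableSpace α] (p : Measure α)
    [IsZeroOrProbabilityMeasure p] (s : Set α) : 0 ≤ Real.negMulLog (p.real s) :=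
  Real.negMulLog_nonneg measureReal_nonneg measureReal_le_one

lemma entropy_nonneg {α : Type*} [MeasurableSpace α] (p : Measure α)
    [IsZeroOrProbabilityMeasure p] : 0 ≤ USK.entropy p :=
  tsum_nonneg fun _ => negMulLog_measureReal_nonneg p _

/-- Conditioning a uniform law on a set that contains at least two of its atoms gives a law of
positive entropy. -/
lemma entropy_cond_uniformOn_pos {α : Type*} [MeasurableSpace α] [MeasurableSingletonClass α]
    {N T : Set α} (hN : N.Finite) {x x' : α} (hx : x ∈ N ∩ T) (hx' : x' ∈ N ∩ T) (hne : x ≠ x') :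
    0 < USK.entropy (cond (uniformOn N) T) := by
  have := isProbabilityMeasure_uniformOn hN ⟨x, hx.1⟩
  have hpos : ∀ z ∈ N ∩ T, 0 < (cond (uniformOn N) T).real {z} := by
    intro z hz
    refine ENNReal.toReal_pos ?_ (measure_ne_top _ _)
    rw [cond_apply' (measurableSet_singleton z)]
    refine mul_ne_zero (ENNReal.inv_ne_zero.2 (measure_ne_top _ _)) ?_
    rw [Ne, uniformOn_eq_zero_iff hN]
    exact Set.Nonempty.ne_empty ⟨z, hz.1, hz.2, rfl⟩
  have hlt : (cond (uniformOn N) T).real {x} < 1 := by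
    have h1 : (cond (uniformOn N) T).real {x} + (cond (uniformOn N) T).real {x'} ≤ 1 := by
      rw [← measureReal_union (by simpa using hne) (measurableSet_singleton x')]
      exact measureReal_le_one
    linarith [hpos x' hx']
  refine Summable.tsum_pos ?_ (fun _ => negMulLog_measureReal_nonneg _ _) x ?_
  · refine summable_of_hasFiniteSupport (hN.subset fun z hz => ?_)
    by_contra hzN
    refine hz ?_
    have : cond (uniformOn N) T {z} = 0 := by
      rw [cond_apply' (measurableSet_singleton z), (uniformOn_eq_zero_iff (t := T ∩ {z}) hN).2,
        mul_zero]
      refine Set.eq_empty_of_forall_notMem ?_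
      rintro _ ⟨h1, -, rfl⟩
      exact hzN h1
    simp [Measure.real, this]
  · rw [Real.negMulLog]
    have := Real.log_neg (hpos x hx) hlt
    nlinarith [hpos x hx]

lemma equivocation_pos {NA NB NE M B : ℕ} {Pv : ℝ} {Ω : Type*} [MeasurableSpace Ω] {μ : Measure Ω}
    (S : USK.Scheme NA NB NE M Pv B μ) (h : NB ≤ NA) {i : Fin B} {ω : Ω} (hL : 2 ≤ S.L h i ω) :
    0 < S.equivocation h ω := by
  have hinst : ∀ k, IsZeroOrProbabilityMeasure (S.posterior h k ω) := fun k => by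
    unfold USK.Scheme.posterior; infer_instance
  refine Finset.sum_pos' (fun k _ => entropy_nonneg _) ⟨i, Finset.mem_univ i, ?_⟩
  obtain ⟨p, q, hp, hq, hne⟩ := (Set.one_lt_ncard_iff
    ((finite_finiteLattice _ M).subset Set.inter_subset_right)).1 (show 1 < S.L h i ω from hL)
  obtain ⟨x, hx, rfl⟩ := hp.2
  obtain ⟨x', hx', rfl⟩ := hq.2
  exact entropy_cond_uniformOn_pos (finite_qamVec M NB) ⟨hx, hp⟩ ⟨hx', hq⟩
    fun h => hne (by rw [h])

open Classical in
/-- The direction of `v`, with the value `e₀` at the zero vector. -/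
noncomputable def unitDirection {n : ℕ} (e₀ v : Fin n → ℂ) : Fin n → ℂ :=
  if USK.len v = 0 then e₀ else ((USK.len v : ℂ))⁻¹ • v

lemma len_unitDirection {n : ℕ} {e₀ : Fin n → ℂ} (he₀ : USK.len e₀ = 1) (v : Fin n → ℂ) :
    USK.len (unitDirection e₀ v) = 1 := by
  unfold unitDirection
  split_ifs with h
  · exact he₀
  · rw [len_smul, norm_inv, Complex.norm_real,
      Real.norm_of_nonneg (show 0 ≤ USK.len v from norm_nonneg _), inv_mul_cancel₀ h]

lemma len_smul_unitDirection {n : ℕ} (e₀ v : Fin n → ℂ) :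
    v = (USK.len v : ℂ) • unitDirection e₀ v := by
  unfold unitDirection
  split_ifs with h
  · have : v = 0 := by simpa [USK.len] using h
    rw [h, this]; simp
  · rw [smul_smul, mul_inv_cancel₀ (by exact_mod_cast h), one_smul]

lemma measurable_unitDirection {n : ℕ} (e₀ : Fin n → ℂ) : Measurable (unitDirection e₀) := by
  classical
  unfold unitDirection
  refine Measurable.ite (measurable_len (measurableSet_singleton 0)) measurable_const ?_
  have := measurable_len (n := n)
  fun_prop

lemma measurableSet_nearlyOrthogonal {X : Type*} [MeasurableSpace X] {m n : ℕ} (τ : ℝ)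
    {A : X → Matrix (Fin m) (Fin n) ℂ} {w : X → Fin m → ℂ}
    (hA : ∀ k j, Measurable fun x => A x k j) (hw : Measurable w) :
    MeasurableSet {x | NearlyOrthogonal τ (A x) (w x)} := by
  simp only [NearlyOrthogonal, Set.ofPred_forall]
  have hcol : ∀ j, Measurable fun x k => A x k j := fun j => measurable_pi_lambda _ fun k => hA k j
  refine MeasurableSet.iInter fun j => measurableSet_le ?_ ?_
  · have h1 := hcol j
    fun_prop
  · exact ((measurable_len.comp (hcol j)).pow_const 2).const_mul τ

lemma measurable_curry_mul {NE NA K : ℕ} (Q : Matrix (Fin NA) (Fin K) ℂ) (k : Fin NE) (j : Fin K) :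
    Measurable fun x : Fin NE × Fin NA → ℂ => (Matrix.of (fun a b => x (a, b)) * Q) k j := by
  simp only [Matrix.mul_apply, Matrix.of_apply]
  fun_prop

/-- The outage probability of `B` uses is at most the `B`-th power of the failure probability of
one use. -/
lemma outage_measure_le {NA NB NE M B d m : ℕ} (h : NB ≤ NA) (hlt : NB < NA) (hM : 0 < M)
    (hd : 0 < d) (hmE : m ≤ NE) (hmB : m ≤ NB) {Pv : ℝ} (hPv : 0 < Pv)
    {Ω : Type*} [MeasurableSpace Ω] {μ : Measure Ω} [IsProbabilityMeasure μ]
    (S : USK.Scheme NA NB NE M Pv B μ) :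
    μ {ω | ∀ i, S.L h i ω < d} ≤ (NB * ((4 * d : ℕ) / (Nat.sqrt M : ℝ≥0∞)) +
      (ENNReal.ofReal (2 * d / √Pv) * smallBallConst (Fin NE)) ^ m *
        (1 + ∫⁻ z, ‖z‖ₑ⁻¹ ∂(USK.complexGaussian 1)) ^ NE) ^ B := by
  set e₀ : Fin (NA - NB) → ℂ := Pi.single ⟨0, by omega⟩ 1 with he₀
  have he₀1 : USK.len e₀ = 1 := by
    simp [USK.len, he₀]
  set τ : ℝ := 2 * d / √Pv with hτ
  have hτ0 : 0 < τ := by positivity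
  set X : Fin B → Ω → Fin NE × Fin NA → ℂ := fun i ω p => S.G i ω p.1 p.2
  set E : Fin B → Set ((Fin NE × Fin NA → ℂ) × (Fin (NA - NB) → ℂ)) := fun i =>
    {q | NearlyOrthogonal τ (Matrix.of (fun a b => q.1 (a, b)) * USK.leftBlock h (S.V i))
      ((Matrix.of (fun a b => q.1 (a, b)) * USK.rightBlock h (S.V i)) *ᵥ unitDirection e₀ q.2)}

  have hEm : ∀ i, MeasurableSet (E i) := by
    intro i
    refine measurableSet_nearlyOrthogonal τ
      (fun k j => (measurable_curry_mul _ k j).comp measurable_fst) ?_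
    refine measurable_pi_lambda _ fun k => ?_
    simp only [Matrix.mulVec, dotProduct]
    refine Finset.measurable_sum _ fun j _ => ?_
    exact ((measurable_curry_mul _ k j).comp measurable_fst).mul
      ((measurable_pi_apply j).comp ((measurable_unitDirection e₀).comp measurable_snd))
  have hXm : ∀ i, Measurable (X i) := fun i =>
    measurable_pi_lambda _ fun p => S.measurable_G i p.1 p.2
  have hflatm : Measurable fun ω (p : Fin B × Fin NE × Fin NA) => S.G p.1 ω p.2.1 p.2.2 :=
    measurable_pi_lambda _ fun p => S.measurable_G _ _ _
  have hflat : μ.map (fun ω (p : Fin B × Fin NE × Fin NA) => S.G p.1 ω p.2.1 p.2.2)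
      = stdComplexGaussian (Fin B × Fin NE × Fin NA) := by
    refine ((iIndepFun_iff_map_fun_eq_pi_map fun p : Fin B × Fin NE × Fin NA =>
      (S.measurable_G p.1 p.2.1 p.2.2).aemeasurable).1 S.indep_G).trans ?_
    exact congrArg Measure.pi (funext fun p => (S.law_G p.1 p.2.1 p.2.2).map_eq)
  have hXlaw : ∀ i, μ.map (X i) = stdComplexGaussian (Fin NE × Fin NA) := by
    intro i
    rw [← stdComplexGaussian_map_precomp (f := fun q : Fin NE × Fin NA => (i, q))
      (Prod.mk_right_injective i), ← hflat, Measure.map_map (by fun_prop) hflatm]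
    rfl
  have hXindep : iIndepFun X μ := by
    rw [iIndepFun_iff_map_fun_eq_pi_map fun i => (hXm i).aemeasurable]
    simp only [hXlaw]
    rw [← stdComplexGaussian_map_curry, ← hflat, Measure.map_map (by fun_prop) hflatm]
    rfl
  have hXuv : IndepFun (fun ω i => X i ω) (fun ω => ((fun i => S.u i ω), (fun i => S.v i ω))) μ :=
    S.indep_G_uv.comp (show Measurable fun (x : Fin B × Fin NE × Fin NA → ℂ) i q => x (i, q) by
      fun_prop) measurable_id
  refine le_trans (measure_mono_ae ?_) (measure_forall_or_le hXm S.measurable_u S.measurable_v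
    hXindep S.indep_u S.indep_u_v hXuv (measurableSet_nearBoundary M NB d) hEm ?_ ?_)
  · filter_upwards [ae_all_iff.2 S.mem_v] with ω hv hL i
    by_contra hcon
    rw [not_or] at hcon
    exact absurd (hL i) (not_lt.2 (le_ncard_ball_inter_finiteLattice hPv hcon.1 (hv i)
      (len_unitDirection he₀1 _) (len_smul_unitDirection e₀ _) hcon.2))
  · intro i
    rw [(S.law_u i).map_eq]
    exact uniformOn_qamVec_nearBoundary_le hM NB d
  · intro i v
    rw [hXlaw]
    have key := pi_stdComplexGaussian_nearlyOrthogonal_le NE h (S.svd i).unitary_right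
      (len_unitDirection he₀1 v) hmE hmB hτ0
    rw [← stdComplexGaussian_map_curry] at key
    have hcurry : Measurable fun (x : Fin NE × Fin NA → ℂ) i j => x (i, j) := by fun_prop
    exact (Measure.le_map_apply hcurry.aemeasurable _).trans key

theorem theorem3 (NA NB NE : ℕ) (hNB : 1 ≤ NB) (hBE : NB ≤ NE) (hEA : NE < NA)
    (d : ℕ) (hd : 2 ≤ d) :
    ∃ C : ℝ, 0 < C ∧
      ∀ (ε : ℝ), 0 < ε → ε < 1 →
      ∀ (Pv : ℝ), Pv = ε ^ (-2 / (USK.Nmin NB NE : ℝ)) * USK.kappa NE d ^ 2 /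
          USK.Phi NB NE ^ (2 * (NB : ℝ) / (NE : ℝ)) →
      ∀ (M : ℕ), IsSquare M →
        ε ^ (-3 - 2 / (USK.Nmin NB NE : ℝ)) * USK.kappa NE d ^ 2 ≤ (M : ℝ) →
      ∀ (B : ℕ), 1 ≤ B →
      ∀ (Ω : Type*) [MeasurableSpace Ω] (μ : Measure Ω) [IsProbabilityMeasure μ]
        (S : USK.Scheme NA NB NE M Pv B μ),
        S.outageProb (hBE.trans hEA.le) d < (C * ε) ^ B ∧
        1 - (C * ε) ^ B < S.idealSecrecyProb (hBE.trans hEA.le) := by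
  have hκ : 0 < USK.kappa NE d := by unfold USK.kappa; positivity
  have hΦ : 0 < USK.Phi NB NE := by unfold USK.Phi; positivity
  set κ := USK.kappa NE d
  set m := USK.Nmin NB NE with hm
  have hmB : m ≤ NB := min_le_right _ _
  have hmE : m ≤ NE := hmB.trans hBE
  have hm0 : m ≠ 0 := by rw [hm, USK.Nmin]; omega
  set K : ℝ := κ ^ 2 / USK.Phi NB NE ^ (2 * (NB : ℝ) / (NE : ℝ)) with hK
  have hK0 : 0 < K := by positivity
  set c₁ := (smallBallConst (Fin NE)).toReal with hc₁
  set c₂ := (1 + ∫⁻ z, ‖z‖ₑ⁻¹ ∂(USK.complexGaussian 1)).toReal with hc₂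
  set C₀ : ℝ := NB * (4 * d / κ) + (2 * d / √K * c₁) ^ m * c₂ ^ NE with hC₀
  have hc₁0 : 0 ≤ c₁ := ENNReal.toReal_nonneg
  have hc₂0 : 0 ≤ c₂ := ENNReal.toReal_nonneg
  have hC₀0 : 0 ≤ C₀ := by positivity
  refine ⟨C₀ + 1, by positivity, ?_⟩
  intro ε hε hε1 Pv hPv M hMsq hMle B hB Ω _ μ _ S
  have hPvK : Pv = (ε ^ (-1 / (m : ℝ))) ^ 2 * K := by
    rw [hPv, hK, ← Real.rpow_natCast (ε ^ (-1 / (m : ℝ))), ← Real.rpow_mul hε.le, mul_div_assoc]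
    congr 2
    push_cast
    ring
  have hεm : 0 < ε ^ (-1 / (m : ℝ)) := Real.rpow_pos_of_pos hε _
  have hPv0 : 0 < Pv := by rw [hPvK]; positivity
  have hsqrt : √Pv = ε ^ (-1 / (m : ℝ)) * √K := by
    rw [hPvK, Real.sqrt_mul (by positivity), Real.sqrt_sq hεm.le]
  have hτm : (2 * d / √Pv * c₁) ^ m = (2 * d / √K * c₁) ^ m * ε := by
    have h1 : (ε ^ (-1 / (m : ℝ)))⁻¹ ^ m = ε := by
      rw [← Real.rpow_neg hε.le, ← Real.rpow_natCast, ← Real.rpow_mul hε.le]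
      have : -(-1 / (m : ℝ)) * m = 1 := by
        have : (m : ℝ) ≠ 0 := by exact_mod_cast hm0
        field_simp
      rw [this, Real.rpow_one]
    calc _ = (2 * d / √K * c₁ * (ε ^ (-1 / (m : ℝ)))⁻¹) ^ m := by
          rw [hsqrt]; congr 1; field_simp
      _ = _ := by rw [mul_pow, h1]
  obtain ⟨s, hs⟩ := hMsq
  have hsM : Nat.sqrt M = s := by rw [hs, Nat.sqrt_eq]
  have hs' : κ / ε ≤ s := by
    have h1 : (κ / ε) ^ 2 ≤ (s : ℝ) ^ 2 := by
      have h2 : ε ^ (-2 : ℝ) ≤ ε ^ (-3 - 2 / (m : ℝ)) := by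
        refine Real.rpow_le_rpow_of_exponent_ge hε hε1.le ?_
        have : (0 : ℝ) ≤ 2 / m := by positivity
        linarith
      have h3 : ε ^ (-2 : ℝ) = (ε ^ 2)⁻¹ := by
        rw [Real.rpow_neg hε.le, Real.rpow_two]
      calc (κ / ε) ^ 2 = ε ^ (-2 : ℝ) * κ ^ 2 := by rw [h3]; field_simp
        _ ≤ ε ^ (-3 - 2 / (m : ℝ)) * κ ^ 2 := by gcongr
        _ ≤ M := hMle
        _ = (s : ℝ) ^ 2 := by rw [hs]; push_cast; ring
    exact le_of_sq_le_sq h1 (Nat.cast_nonneg s)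
  have hs0 : (0 : ℝ) < s := lt_of_lt_of_le (by positivity) hs'
  have hM0 : 0 < M := by
    have : 0 < s := by exact_mod_cast hs0
    rw [hs]; positivity
  have hbound := outage_measure_le (hBE.trans hEA.le) (hBE.trans_lt hEA) hM0 (by omega : 0 < d)
    hmE hmB hPv0 S
  have hle : (NB * ((4 * d : ℕ) / (Nat.sqrt M : ℝ≥0∞)) +
      (ENNReal.ofReal (2 * d / √Pv) * smallBallConst (Fin NE)) ^ m *
        (1 + ∫⁻ z, ‖z‖ₑ⁻¹ ∂(USK.complexGaussian 1)) ^ NE) ≤ ENNReal.ofReal (C₀ * ε) := by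
    have e1 : smallBallConst (Fin NE) = ENNReal.ofReal c₁ :=
      (ENNReal.ofReal_toReal (smallBallConst_lt_top _).ne).symm
    have e2 : (1 + ∫⁻ z, ‖z‖ₑ⁻¹ ∂(USK.complexGaussian 1)) = ENNReal.ofReal c₂ :=
      (ENNReal.ofReal_toReal
        (ENNReal.add_lt_top.2 ⟨ENNReal.one_lt_top, lintegral_enorm_inv_lt_top⟩).ne).symm
    have e3 : (NB * ((4 * d : ℕ) / (Nat.sqrt M : ℝ≥0∞)) : ℝ≥0∞)
        = ENNReal.ofReal (NB * (4 * d / s)) := by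
      rw [hsM, ENNReal.ofReal_mul (Nat.cast_nonneg _), ENNReal.ofReal_div_of_pos hs0,
        ENNReal.ofReal_natCast, ENNReal.ofReal_natCast, ← ENNReal.ofReal_natCast (4 * d)]
      push_cast
      rfl
    rw [e1, e2, e3, ← ENNReal.ofReal_mul (by positivity), ← ENNReal.ofReal_pow (by positivity),
      ← ENNReal.ofReal_pow (by positivity), ← ENNReal.ofReal_mul (by positivity),
      ← ENNReal.ofReal_add (by positivity) (by positivity)]
    refine ENNReal.ofReal_le_ofReal ?_
    rw [hτm, hC₀, add_mul]
    refine add_le_add ?_ (le_of_eq (by ring))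
    have h4 : 4 * (d : ℝ) / s ≤ 4 * d / (κ / ε) := by gcongr
    calc (NB : ℝ) * (4 * d / s) ≤ NB * (4 * d / (κ / ε)) := by gcongr
      _ = _ := by field_simp
  have hout : S.outageProb (hBE.trans hEA.le) d < ((C₀ + 1) * ε) ^ B := by
    have h1 : S.outageProb (hBE.trans hEA.le) d ≤ (C₀ * ε) ^ B := by
      refine ENNReal.toReal_le_of_le_ofReal (by positivity) ?_
      rw [ENNReal.ofReal_pow (by positivity)]
      exact hbound.trans (pow_le_pow_left' hle B)
    refine h1.trans_lt (pow_lt_pow_left₀ ?_ (by positivity) (by omega))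
    exact mul_lt_mul_of_pos_right (by linarith) hε
  refine ⟨hout, ?_⟩
  have hcover : (Set.univ : Set Ω) ⊆ {ω | S.equivocation (hBE.trans hEA.le) ω ≠ 0} ∪
      {ω | ∀ i, S.L (hBE.trans hEA.le) i ω < d} := by
    intro ω _
    by_cases hω : ∀ i, S.L (hBE.trans hEA.le) i ω < d
    · exact Or.inr hω
    · push Not at hω
      obtain ⟨i, hi⟩ := hω
      exact Or.inl (equivocation_pos S _ (hd.trans hi)).ne'
  have h1 : 1 ≤ S.idealSecrecyProb (hBE.trans hEA.le) + S.outageProb (hBE.trans hEA.le) d := by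
    rw [← probReal_univ (μ := μ)]
    exact (measureReal_mono hcover).trans (measureReal_union_le _ _)
  linarith
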